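/- A $2$-edge-colored multigraph is a loopless multigraph each of whose edges has one of two colors, such that no two parallel edges have the same color. Its rainbow degree is the minimum, over all vertices $x$, of the number of different colors on the edges incident to $x$. A cycle is proper if any two adjacent edges of it have different colors, and Hamiltonian if it contains all the vertices. Let $G$ be a $2$-edge-colored multigraph on $n \ge 9$ vertices with rainbow degree $2$ and with $m \ge \binom{n}{2} + \binom{n-2}{2} + 3$ edges. If $n$ is even, then $G$ has a proper Hamiltonian cycle; if $n$ is odd, then $G$ has a proper cycle of length $n-1$. The bound is tight for even $n$: for every even $n \ge 9$ there is a connected $2$-edge-colored multigraph on $n$ vertices with rainbow degree $2$ and exactly $\binom{n}{2} + \binom{n-2}{2} + 2$ edges that has no proper Hamiltonian cycle. -/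

import Mathlib

/-- A `c`-edge-colored multigraph on the vertex set `V`: edges carry one of `c` colors, there are
no loops, and no two parallel edges have the same color.  Equivalently, for every color `i` the
edges of color `i` form a simple graph `layer i` on `V`. -/
structure EdgeColoredMultigraph (V : Type*) (c : ℕ) where
  /-- the spanning subgraph formed by the edges of a given color -/
  layer : Fin c → SimpleGraph V

namespace EdgeColoredMultigraph

variable {V : Type*} {c : ℕ}

/-- The edges, each given by its pair of endpoints together with its color. -/
def edgeSet (G : EdgeColoredMultigraph V c) : Set (Sym2 V × Fin c) :=
  {e | e.1 ∈ (G.layer e.2).edgeSet}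

/-- The number of edges (parallel edges of different colors are counted separately). -/
noncomputable def numEdges (G : EdgeColoredMultigraph V c) : ℕ :=
  G.edgeSet.ncard

/-- The rainbow degree of a vertex: the number of colors on the edges incident to it. -/
noncomputable def vertexRainbowDegree (G : EdgeColoredMultigraph V c) (x : V) : ℕ :=
  {i : Fin c | ∃ y, (G.layer i).Adj x y}.ncard

/-- The rainbow degree of a multigraph: the minimum of the rainbow degrees of its vertices. -/
noncomputable def rainbowDegree (G : EdgeColoredMultigraph V c) : ℕ :=
  ⨅ x : V, G.vertexRainbowDegree x

/-- A multigraph is connected if its underlying simple graph (forget colors and multiplicities)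
is connected. -/
def Connected (G : EdgeColoredMultigraph V c) : Prop :=
  (⨆ i, G.layer i).Connected

/-- A proper cycle of length `k`: distinct vertices `v₀, …, vₖ₋₁` and, for each `i`, an edge of `G`
of color `color i` joining `vᵢ` to the cyclically next vertex, so that cyclically consecutive edges
have different colors. The map `finRotate k` is the cyclic successor `i ↦ i + 1` modulo `k`. -/
structure ProperCycle (G : EdgeColoredMultigraph V c) (k : ℕ) where
  two_le : 2 ≤ k
  vertex : Fin k → V
  color : Fin k → Fin c
  injective : Function.Injective vertex
  adj : ∀ i, (G.layer (color i)).Adj (vertex i) (vertex (finRotate k i))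
  proper : ∀ i, color i ≠ color (finRotate k i)

/-- There is a proper cycle of length `k`. -/
def HasProperCycle (G : EdgeColoredMultigraph V c) (k : ℕ) : Prop :=
  Nonempty (G.ProperCycle k)

/-- There is a proper cycle that contains all the vertices. -/
def HasProperHamiltonianCycle (G : EdgeColoredMultigraph V c) : Prop :=
  ∃ (k : ℕ) (C : G.ProperCycle k), Function.Surjective C.vertex

end EdgeColoredMultigraph

/-! Count ordered pairs of distinct vertices that are not joined in a given color. The edge bound
says that the two colors together miss at most `4n - 12` such pairs. Let `c` be the color missing
more and `c'` the other, so `c'` misses at most `2n - 6`.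

For even `n`, Tutte's theorem gives a perfect matching in color `c`
(`exists_isPerfectMatching_of_ncard_nonadjPairs_le`). Arrange its `k = n/2` edges in a random cyclic
order with random orientations. Each of the `k` junctions is uniform among `4k(k - 1)` ordered
pairs, so the expected number of junctions missing in `c'` is at most `(2n - 6) / (4(k - 1)) < 1`.
Some arrangement has none, and it closes up to an alternating cycle (`exists_perm_orientation`,
`hasProperCycle_of_pairs`).

For odd `n = 2k + 1`, a matching in color `c` leaves one vertex out. Now `4(k - 1) = 2n - 6`, so
averaging just fails when `c'` misses exactly that many pairs; then the vertex left out is chosen on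
a missing pair of `c'` (`exists_pairs_of_odd`).

For tightness, in `twoPendant` two vertices have the same vertex as their only neighbor in color
`1`. -/

namespace SimpleGraph

/-! ### Missing pairs and perfect matchings. -/

variable {V : Type*}

/-- The ordered pairs of distinct nonadjacent vertices. -/
def nonadjPairs (Γ : SimpleGraph V) : Set (V × V) := {p | p.1 ≠ p.2 ∧ ¬ Γ.Adj p.1 p.2}

theorem swap_mem_nonadjPairs {Γ : SimpleGraph V} {p : V × V} (hp : p ∈ Γ.nonadjPairs) :
    p.swap ∈ Γ.nonadjPairs :=
  ⟨hp.1.symm, fun h => hp.2 h.symm⟩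

theorem two_mul_ncard_edgeSet_add_ncard_nonadjPairs [Fintype V] (Γ : SimpleGraph V) :
    2 * Γ.edgeSet.ncard + Γ.nonadjPairs.ncard = Fintype.card V * (Fintype.card V - 1) := by
  classical
  have hd : 2 * Γ.edgeSet.ncard = {p : V × V | Γ.Adj p.1 p.2}.ncard := by
    rw [← coe_edgeFinset, Set.ncard_coe_finset, ← Γ.dart_card_eq_twice_card_edges,
      ← Nat.card_eq_fintype_card, ← Nat.card_coe_set_eq]
    exact Nat.card_congr
      { toFun := fun d => ⟨d.toProd, d.adj⟩
        invFun := fun p => ⟨p.1, p.2⟩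
        left_inv := fun _ => rfl
        right_inv := fun _ => rfl }
  have hu : {p : V × V | Γ.Adj p.1 p.2} ∪ Γ.nonadjPairs =
      ((Finset.univ : Finset V).offDiag : Set (V × V)) := by
    ext p
    simp only [nonadjPairs, Set.mem_union, Set.mem_ofPred_eq, Finset.coe_offDiag, Set.mem_offDiag,
      Finset.coe_univ, Set.mem_univ, true_and]
    constructor
    · rintro (h | h)
      exacts [h.ne, h.1]
    · intro h
      by_cases h' : Γ.Adj p.1 p.2
      exacts [Or.inl h', Or.inr ⟨h, h'⟩]
  have hdj : Disjoint {p : V × V | Γ.Adj p.1 p.2} Γ.nonadjPairs :=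
    Set.disjoint_left.2 fun p hp hq => hq.2 hp
  rw [hd, ← Set.ncard_union_eq hdj (Set.toFinite _) (Set.toFinite _), hu, Set.ncard_coe_finset,
    Finset.offDiag_card, Finset.card_univ, Nat.mul_sub_one]

/-- If `t` vertices lie in distinct connected components, then there are at least
`(t - 1) * (2 * |V| - t)` ordered pairs of nonadjacent vertices. -/
theorem le_ncard_nonadjPairs_of_injOn [Fintype V] (Γ : SimpleGraph V) (R : Finset V)
    (hR : Set.InjOn Γ.connectedComponentMk R) :
    (R.card - 1) * (2 * Fintype.card V - R.card) ≤ Γ.nonadjPairs.ncard := by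
  classical
  let P : V × V → Prop := fun p => Γ.connectedComponentMk p.1 ≠ Γ.connectedComponentMk p.2
  have hP : ∀ p, P p → p ∈ Γ.nonadjPairs := by
    intro p hp
    refine ⟨fun h => hp (by rw [h]), fun h => hp ?_⟩
    exact ConnectedComponent.eq.2 h.reachable
  -- A vertex shares its component with at most one element of `R`.
  have key : ∀ A : Finset V, A.card * (R.card - 1) ≤ ((A ×ˢ R).filter P).card := by
    intro A
    have h1 : ((A ×ˢ R).filter P).card = ∑ a ∈ A, (R.filter fun r => P (a, r)).card := by
      simp only [Finset.card_filter, Finset.sum_product]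
    rw [h1, ← smul_eq_mul, ← Finset.sum_const]
    refine Finset.sum_le_sum fun a _ => ?_
    have h2 := Finset.card_filter_add_card_filter_not (s := R) (fun r => P (a, r))
    have h3 : (R.filter fun r => ¬ P (a, r)).card ≤ 1 := by
      refine Finset.card_le_one.2 fun x hx y hy => ?_
      simp only [Finset.mem_filter, P, not_not] at hx hy
      exact hR hx.1 hy.1 (hx.2.symm.trans hy.2)
    omega
  -- `X` has second coordinates in `R` and the reversed pairs `Y` have them outside `R`, so nothing
  -- is counted twice.
  let X := (Finset.univ ×ˢ R).filter P
  let Y := ((Rᶜ ×ˢ R).filter P).map (Equiv.prodComm V V).toEmbedding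
  have hXY : Disjoint X Y := by
    refine Finset.disjoint_left.2 fun p hp hq => ?_
    obtain ⟨q, hq', rfl⟩ := Finset.mem_map.1 hq
    simp only [X, Finset.mem_filter, Finset.mem_product, Finset.mem_compl] at hp hq'
    exact hq'.1.1 hp.1.2
  have hsub : ((X ∪ Y : Finset (V × V)) : Set (V × V)) ⊆ Γ.nonadjPairs := by
    intro p hp
    rcases Finset.mem_union.1 (Finset.mem_coe.1 hp) with hp | hp
    · exact hP p (Finset.mem_filter.1 hp).2
    · obtain ⟨q, hq, rfl⟩ := Finset.mem_map.1 hp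
      exact swap_mem_nonadjPairs (hP q (Finset.mem_filter.1 hq).2)
  have hle := Set.ncard_le_ncard hsub (Set.toFinite _)
  rw [Set.ncard_coe_finset, Finset.card_union_of_disjoint hXY, Finset.card_map] at hle
  have k1 := key Finset.univ
  have k2 := key Rᶜ
  rw [Finset.card_compl] at k2
  rw [Finset.card_univ] at k1
  have hc : R.card ≤ Fintype.card V := R.card_le_univ
  have : 2 * Fintype.card V - R.card = Fintype.card V + (Fintype.card V - R.card) := by omega
  rw [this, mul_comm, add_mul]
  exact (add_le_add k1 k2).trans hle

theorem le_ncard_nonadjPairs_of_separated [Fintype V] (Γ : SimpleGraph V) (A : Finset V)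
    (hA : ∀ a ∈ A, ∀ b ∉ A, ¬ Γ.Adj a b) :
    2 * (A.card * (Fintype.card V - A.card)) ≤ Γ.nonadjPairs.ncard := by
  classical
  have hdj : Disjoint (A ×ˢ Aᶜ) (Aᶜ ×ˢ A) := by
    refine Finset.disjoint_left.2 fun p hp hq => ?_
    simp only [Finset.mem_product, Finset.mem_compl] at hp hq
    exact hq.1 hp.1
  have hsub : ((A ×ˢ Aᶜ ∪ Aᶜ ×ˢ A : Finset (V × V)) : Set (V × V)) ⊆ Γ.nonadjPairs := by
    have h1 : ∀ p ∈ A ×ˢ Aᶜ, p ∈ Γ.nonadjPairs := by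
      intro p hp
      simp only [Finset.mem_product, Finset.mem_compl] at hp
      exact ⟨fun h => hp.2 (h ▸ hp.1), hA _ hp.1 _ hp.2⟩
    intro p hp
    rcases Finset.mem_union.1 (Finset.mem_coe.1 hp) with hp | hp
    · exact h1 p hp
    · have := h1 p.swap (by simpa [and_comm] using hp)
      simpa using swap_mem_nonadjPairs this
  have hle := Set.ncard_le_ncard hsub (Set.toFinite _)
  rw [Set.ncard_coe_finset, Finset.card_union_of_disjoint hdj, Finset.card_product,
    Finset.card_product, Finset.card_compl] at hle
  calc _ = _ := by ring
    _ ≤ _ := hle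

/-- A graph without isolated vertices on an even number `N ≥ 10` of vertices that misses at most
`2 * N - 6` edges has a perfect matching. -/
theorem exists_isPerfectMatching_of_ncard_nonadjPairs_le [Fintype V] (Γ : SimpleGraph V)
    (hN : 10 ≤ Fintype.card V) (heven : Even (Fintype.card V)) (hdeg : ∀ v, ∃ w, Γ.Adj v w)
    (hcard : Γ.nonadjPairs.ncard + 12 ≤ 4 * Fintype.card V) :
    ∃ M : Γ.Subgraph, M.IsPerfectMatching := by
  classical
  rw [tutte]
  intro S hS
  rw [IsTutteViolator] at hS
  set H := (⊤ : Γ.Subgraph).deleteVerts S with hH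
  have hverts : ∀ v, v ∈ H.verts ↔ v ∉ S := by simp [hH]
  have hadj : ∀ a b : H.verts, H.coe.Adj a b ↔ Γ.Adj a b := by
    intro a b
    have ha := (hverts a).1 a.2
    have hb := (hverts b).1 b.2
    simp [hH, ha, hb]
  have hcV : Fintype.card H.verts + S.ncard = Fintype.card V := by
    have h1 : H.verts = Sᶜ := by ext v; simp [hverts]
    have h2 := Set.ncard_add_ncard_compl S
    rw [← h1, Nat.card_eq_fintype_card] at h2
    rw [← Nat.card_eq_fintype_card, Nat.card_coe_set_eq]
    omega
  have hmono : H.coe.nonadjPairs.ncard ≤ Γ.nonadjPairs.ncard := by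
    refine Set.ncard_le_ncard_of_injOn (fun p => (p.1.1, p.2.1)) ?_ ?_ (Set.toFinite _)
    · rintro p ⟨h1, h2⟩
      exact ⟨fun h => h1 (Subtype.ext h), fun h => h2 ((hadj _ _).2 h)⟩
    · intro p _ q _ h
      simp only [Prod.mk.injEq] at h
      exact Prod.ext (Subtype.ext h.1) (Subtype.ext h.2)
  rcases Nat.eq_zero_or_pos S.ncard with h0 | hpos
  -- Without isolated vertices an odd component and its complement both have at least two vertices,
  -- so at least `4N - 8` ordered pairs are missing.
  · have hS0 : S = ∅ := (Set.ncard_eq_zero (Set.toFinite _)).1 h0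
    rw [h0] at hS
    obtain ⟨C, hC⟩ := Set.nonempty_of_ncard_ne_zero hS.ne'
    let A : Finset V := Finset.univ.filter fun v => ∃ h : v ∈ H.verts, (⟨v, h⟩ : H.verts) ∈ C.supp
    have hall : ∀ v, v ∈ H.verts := fun v => by simp [hverts, hS0]
    have hA : ∀ v, v ∈ A ↔ (⟨v, hall v⟩ : H.verts) ∈ C.supp := by
      intro v
      simp [A, hall]
    have hAC : A.card = C.supp.ncard := by
      rw [← Set.ncard_image_of_injective C.supp Subtype.val_injective, ← Set.ncard_coe_finset]
      congr 1
      ext v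
      simp [hA, hall]
    have hcl : ∀ a b, Γ.Adj a b → (a ∈ A ↔ b ∈ A) := by
      intro a b hab
      rw [hA, hA]
      exact ConnectedComponent.mem_supp_congr_adj C ((hadj ⟨a, hall a⟩ ⟨b, hall b⟩).2 hab)
    have hodd : Odd A.card := hAC ▸ hC
    have hge : ∀ B : Finset V, (∀ a b, Γ.Adj a b → (a ∈ B ↔ b ∈ B)) → B.card ≠ 0 →
        2 ≤ B.card := by
      intro B hB hB0
      obtain ⟨a, ha⟩ := Finset.card_ne_zero.1 hB0
      obtain ⟨b, hab⟩ := hdeg a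
      exact Finset.one_lt_card.2 ⟨a, ha, b, (hB a b hab).1 ha, hab.ne⟩
    have hA2 : 2 ≤ A.card := hge A hcl (by rintro h; simp [h] at hodd)
    have hle : A.card ≤ Fintype.card V := A.card_le_univ
    have hne : A.card ≠ Fintype.card V := by
      intro h
      rw [h] at hodd
      exact Nat.not_even_iff_odd.2 hodd heven
    have hB2 : 2 ≤ Fintype.card V - A.card := by
      have := hge Aᶜ (fun a b h => by simp [hcl a b h]) (by rw [Finset.card_compl]; omega)
      rwa [Finset.card_compl] at this
    have hsep := le_ncard_nonadjPairs_of_separated Γ A fun a ha b hb h => hb ((hcl a b h).1 ha)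
    obtain ⟨x, hx⟩ := Nat.exists_eq_add_of_le hA2
    obtain ⟨y, hy⟩ := Nat.exists_eq_add_of_le hB2
    rw [hy, hx] at hsep
    have hxy : Fintype.card V = x + y + 4 := by omega
    nlinarith [Nat.zero_le (x * y)]
  · have hpar := odd_ncard_oddComponents (G := H.coe)
    rw [Nat.card_eq_fintype_card] at hpar
    -- The number of odd components has the parity of `N - |S|`, hence of `|S|`, so an excess of one
    -- is impossible.
    have hge : S.ncard + 2 ≤ H.coe.oddComponents.ncard := by
      by_contra hlt
      have heq : H.coe.oddComponents.ncard = S.ncard + 1 := by omega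
      rw [heq] at hpar
      rw [← hcV] at heven
      grind
    obtain ⟨T, hT, hTc⟩ := Set.exists_subset_card_eq hge
    let R : Finset H.verts := T.toFinite.toFinset.image fun C => C.out
    have hout : ∀ C : H.coe.ConnectedComponent, H.coe.connectedComponentMk C.out = C :=
      fun C => Quot.out_eq C
    have hRc : R.card = S.ncard + 2 := by
      rw [Finset.card_image_of_injective, ← Set.ncard_eq_toFinset_card, hTc]
      intro C D h
      rw [← hout C, ← hout D]
      exact congrArg _ h
    have hinj : Set.InjOn H.coe.connectedComponentMk R := by
      intro a ha b hb h
      simp only [R, Finset.coe_image, Set.mem_image] at ha hb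
      obtain ⟨C, -, rfl⟩ := ha
      obtain ⟨D, -, rfl⟩ := hb
      rw [hout, hout] at h
      rw [h]
    have hb := (le_ncard_nonadjPairs_of_injOn H.coe R hinj).trans hmono
    have hRle : R.card ≤ Fintype.card H.verts := R.card_le_univ
    rw [hRc] at hb hRle
    obtain ⟨s, hs⟩ := Nat.exists_eq_add_of_le' hpos
    obtain ⟨m, hm⟩ := Nat.exists_eq_add_of_le hRle
    have e1 : 2 * Fintype.card H.verts - (S.ncard + 2) = s + 3 + 2 * m := by omega
    have e2 : S.ncard + 2 - 1 = s + 2 := by omega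
    rw [e1, e2] at hb
    have e3 : Fintype.card V = 2 * s + m + 4 := by omega
    rw [e3] at hcard hN
    -- With `|S| = s + 1`, the bounds give `(s - 1)(s - 2) + 2sm ≤ 0` over the integers. Only `m =
    -- 0` with `s = 1` or `s = 2` survives, that is `N = 6` or `N = 8`; this is where `10 ≤ N` is
    -- needed.
    rcases Nat.lt_or_ge s 4 with h4 | h4
    · interval_cases s <;> omega
    · nlinarith [Nat.zero_le (s * m), Nat.zero_le m]

end SimpleGraph

/-! ### Averaging over cyclic orders and orientations. -/

theorem Equiv.Perm.exists_apply_eq_of_ne {α : Type*} [DecidableEq α] {a b c d : α} (hab : a ≠ b)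
    (hcd : c ≠ d) : ∃ τ : Equiv.Perm α, τ a = c ∧ τ b = d := by
  refine ⟨Equiv.swap (Equiv.swap a c b) d * Equiv.swap a c, ?_, ?_⟩
  · rw [Equiv.Perm.mul_apply, Equiv.swap_apply_left]
    refine Equiv.swap_apply_of_ne_of_ne (fun h => hab ?_) hcd
    apply (Equiv.swap a c).injective
    rw [Equiv.swap_apply_left, ← h]
  · rw [Equiv.Perm.mul_apply, Equiv.swap_apply_left]

/-- Permutations act transitively on ordered pairs of distinct points, so `(σ i, σ j)` is uniform
for random `σ`. The factors clear the denominators. -/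
theorem sum_perm_apply_apply {α : Type*} [Fintype α] [DecidableEq α] (F : α → α → ℕ) {i j : α}
    (hij : i ≠ j) :
    Fintype.card α * (Fintype.card α - 1) * ∑ σ : Equiv.Perm α, F (σ i) (σ j) =
      (Fintype.card α).factorial * ∑ p ∈ (Finset.univ : Finset α).offDiag, F p.1 p.2 := by
  have hconst : ∀ p ∈ (Finset.univ : Finset α).offDiag,
      ∑ σ : Equiv.Perm α, F (σ p.1) (σ p.2) = ∑ σ : Equiv.Perm α, F (σ i) (σ j) := by
    intro p hp
    obtain ⟨τ, h1, h2⟩ := Equiv.Perm.exists_apply_eq_of_ne hij (Finset.mem_offDiag.1 hp).2.2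
    rw [← h1, ← h2]
    exact Equiv.sum_comp (Equiv.mulRight τ) fun σ : Equiv.Perm α => F (σ i) (σ j)
  have hinv : ∀ σ : Equiv.Perm α, ∑ p ∈ (Finset.univ : Finset α).offDiag, F (σ p.1) (σ p.2) =
      ∑ p ∈ (Finset.univ : Finset α).offDiag, F p.1 p.2 := by
    intro σ
    refine Finset.sum_equiv (Equiv.prodCongr σ σ) ?_ fun _ _ => rfl
    intro p
    simp [Finset.mem_offDiag]
  have h := Finset.sum_comm (s := (Finset.univ : Finset α).offDiag)
    (t := (Finset.univ : Finset (Equiv.Perm α))) (f := fun p σ => F (σ p.1) (σ p.2))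
  rw [Finset.sum_congr rfl hconst, Finset.sum_congr rfl fun σ _ => hinv σ, Finset.sum_const,
    Finset.sum_const, Finset.offDiag_card, Finset.card_univ, Finset.card_univ,
    Fintype.card_perm, ← Nat.mul_sub_one, smul_eq_mul, smul_eq_mul] at h
  exact h

/-- Flipping the bits at `a` and `b` by a fixed mask permutes the functions `ε`, so `(ε a, ε b)` is
uniform on four values. -/
theorem sum_bool_fun_apply_apply {α : Type*} [Fintype α] [DecidableEq α] (g : Bool → Bool → ℕ)
    {a b : α} (hab : a ≠ b) :
    4 * ∑ ε : α → Bool, g (ε a) (ε b) = 2 ^ Fintype.card α * ∑ u, ∑ v, g u v := by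
  have hflip : ∀ u v : Bool,
      ∑ ε : α → Bool, g (xor u (ε a)) (xor v (ε b)) = ∑ ε : α → Bool, g (ε a) (ε b) := by
    intro u v
    let w : α → Bool := fun x => if x = a then u else v
    have hinv : Function.Involutive fun (ε : α → Bool) x => xor (w x) (ε x) := by
      intro ε
      funext x
      simp
    rw [← Equiv.sum_comp (hinv.toPerm _) fun ε : α → Bool => g (ε a) (ε b)]
    simp [w, hab.symm]
  have hsum : ∑ ε : α → Bool, ∑ u, ∑ v, g (xor u (ε a)) (xor v (ε b)) =
      2 ^ Fintype.card α * ∑ u, ∑ v, g u v := by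
    have : ∀ ε : α → Bool, ∑ u, ∑ v, g (xor u (ε a)) (xor v (ε b)) = ∑ u, ∑ v, g u v := by
      intro ε
      cases ε a <;> cases ε b <;> simp <;> ring
    rw [Finset.sum_congr rfl fun ε _ => this ε, Finset.sum_const, Finset.card_univ]
    simp
  rw [← hsum]
  simp only [Fintype.sum_bool, Finset.sum_add_distrib, hflip]
  ring

theorem finRotate_ne_self {k : ℕ} (hk : 2 ≤ k) (i : Fin k) : i ≠ finRotate k i := by
  obtain ⟨m, rfl⟩ := Nat.exists_eq_add_of_le' (show 1 ≤ k by omega)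
  intro h
  have h' := congrArg Fin.val h
  rw [coe_finRotate] at h'
  split_ifs at h' with hi
  · rw [hi] at h'
    simp at h'
    omega
  · omega

/-- Given `k ≥ 2` pairs of points and fewer than `4 * (k - 1)` forbidden ordered pairs of points
from different pairs, the pairs can be ordered cyclically and oriented in such a way that the end
of each pair followed by the start of the next one is not forbidden. -/
theorem exists_perm_orientation {k : ℕ} (hk : 2 ≤ k) (B : Set ((Fin k × Bool) × (Fin k × Bool)))
    (hB : ∀ p ∈ B, p.1.1 ≠ p.2.1) (hcard : B.ncard < 4 * (k - 1)) :
    ∃ (σ : Equiv.Perm (Fin k)) (ε : Fin k → Bool),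
      ∀ i, ((σ i, !ε (σ i)), (σ (finRotate k i), ε (σ (finRotate k i)))) ∉ B := by
  classical
  let f : Fin k → Bool → Fin k → Bool → ℕ := fun a u b v => if ((a, u), (b, v)) ∈ B then 1 else 0
  let F : Fin k → Fin k → ℕ := fun a b => ∑ u, ∑ v, f a u b v
  have hF : ∑ p ∈ (Finset.univ : Finset (Fin k)).offDiag, F p.1 p.2 = B.ncard := by
    have h1 : ∑ p ∈ (Finset.univ : Finset (Fin k)).offDiag, F p.1 p.2 = ∑ a, ∑ b, F a b := by
      rw [← Fintype.sum_prod_type']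
      refine Finset.sum_subset (Finset.subset_univ _) fun p _ hp => ?_
      have hp' : p.1 = p.2 := by simpa [Finset.mem_offDiag] using hp
      refine Finset.sum_eq_zero fun u _ => Finset.sum_eq_zero fun v _ => ?_
      exact if_neg fun h => hB _ h hp'
    rw [h1, Set.ncard_eq_toFinset_card', ← Set.filter_mem_univ_eq_toFinset, Finset.card_filter]
    simp only [Fintype.sum_prod_type]
    refine Finset.sum_congr rfl fun a _ => ?_
    rw [Finset.sum_comm]
  have hε : ∀ (σ : Equiv.Perm (Fin k)) (i : Fin k),
      4 * ∑ ε : Fin k → Bool,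
        f (σ i) (!ε (σ i)) (σ (finRotate k i)) (ε (σ (finRotate k i))) =
      2 ^ k * F (σ i) (σ (finRotate k i)) := by
    intro σ i
    have := sum_bool_fun_apply_apply (fun u v => f (σ i) (!u) (σ (finRotate k i)) v)
      (σ.injective.ne (finRotate_ne_self hk i))
    rw [this, Fintype.card_fin]
    simp only [F, Fintype.sum_bool, Bool.not_true, Bool.not_false]
    ring
  have hσ : ∀ i : Fin k, k * (k - 1) * ∑ σ : Equiv.Perm (Fin k), F (σ i) (σ (finRotate k i)) =
      k.factorial * B.ncard := by
    intro i
    have := sum_perm_apply_apply F (finRotate_ne_self hk i)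
    rwa [Fintype.card_fin, hF] at this
  -- This is the expected number of forbidden junctions, free of denominators; `hlt` says that it is
  -- below one.
  have htot : 4 * (k * (k - 1)) * ∑ i : Fin k, ∑ σ : Equiv.Perm (Fin k), ∑ ε : Fin k → Bool,
      f (σ i) (!ε (σ i)) (σ (finRotate k i)) (ε (σ (finRotate k i))) =
      k * (2 ^ k * (k.factorial * B.ncard)) := by
    rw [Finset.mul_sum]
    have : ∀ i : Fin k, 4 * (k * (k - 1)) * ∑ σ : Equiv.Perm (Fin k), ∑ ε : Fin k → Bool,
        f (σ i) (!ε (σ i)) (σ (finRotate k i)) (ε (σ (finRotate k i))) =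
        2 ^ k * (k.factorial * B.ncard) := by
      intro i
      rw [← hσ i, mul_comm 4, mul_assoc, Finset.mul_sum, Finset.sum_congr rfl fun σ _ => hε σ i,
        ← Finset.mul_sum]
      ring
    rw [Finset.sum_congr rfl fun i _ => this i, Finset.sum_const, Finset.card_univ,
      Fintype.card_fin, smul_eq_mul]
  have hlt : ∑ i : Fin k, ∑ σ : Equiv.Perm (Fin k), ∑ ε : Fin k → Bool,
      f (σ i) (!ε (σ i)) (σ (finRotate k i)) (ε (σ (finRotate k i))) < k.factorial * 2 ^ k := by
    refine Nat.lt_of_mul_lt_mul_left (a := 4 * (k * (k - 1))) ?_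
    rw [htot]
    have hpos : 0 < k * (2 ^ k * k.factorial) := by positivity
    calc k * (2 ^ k * (k.factorial * B.ncard)) = k * (2 ^ k * k.factorial) * B.ncard := by ring
      _ < k * (2 ^ k * k.factorial) * (4 * (k - 1)) := Nat.mul_lt_mul_of_pos_left hcard hpos
      _ = _ := by ring
  by_contra! hcon
  refine hlt.not_ge ?_
  rw [Finset.sum_comm, Finset.sum_congr rfl fun σ _ => Finset.sum_comm]
  have hone : ∀ (σ : Equiv.Perm (Fin k)) (ε : Fin k → Bool), 1 ≤ ∑ i : Fin k,
      f (σ i) (!ε (σ i)) (σ (finRotate k i)) (ε (σ (finRotate k i))) := by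
    intro σ ε
    obtain ⟨i, hi⟩ := hcon σ ε
    refine le_trans ?_ (Finset.single_le_sum (fun _ _ => Nat.zero_le _) (Finset.mem_univ i))
    exact (if_pos hi).ge
  calc k.factorial * 2 ^ k = ∑ _σ : Equiv.Perm (Fin k), ∑ _ε : Fin k → Bool, 1 := by
        simp [Fintype.card_perm]
    _ ≤ _ := Finset.sum_le_sum fun σ _ => Finset.sum_le_sum fun ε _ => hone σ ε

/-! ### From matchings to alternating cycles. -/

theorem val_finRotate_of_pos {n : ℕ} (hn : 0 < n) (i : Fin n) :
    (finRotate n i : ℕ) = (i + 1) % n := by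
  obtain ⟨m, rfl⟩ := Nat.exists_eq_add_of_le' hn
  rw [coe_finRotate]
  split_ifs with h
  · simp [h]
  · have h1 := i.2
    have h2 : (i : ℕ) ≠ m := fun h' => h (Fin.ext (by simpa using h'))
    rw [Nat.mod_eq_of_lt]
    omega

/-- The pairs of vertices matched by a perfect matching. -/
theorem SimpleGraph.Subgraph.IsPerfectMatching.exists_bijective_adj {V : Type*} [Fintype V]
    {Γ : SimpleGraph V} {M : Γ.Subgraph} (hM : M.IsPerfectMatching) {k : ℕ}
    (hk : Fintype.card V = 2 * k) :
    ∃ e : Fin k × Bool → V, Function.Bijective e ∧ ∀ i, Γ.Adj (e (i, false)) (e (i, true)) := by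
  classical
  let e : M.edgeSet × Bool → V := fun q => if q.2 then (Quot.out q.1.1).2 else (Quot.out q.1.1).1
  have hout : ∀ s : M.edgeSet, M.Adj (Quot.out s.1).1 (Quot.out s.1).2 := by
    intro s
    rw [← SimpleGraph.Subgraph.mem_edgeSet]
    have : s(((Quot.out s.1).1), (Quot.out s.1).2) = s.1 := Quot.out_eq s.1
    rw [this]
    exact s.2
  have hmem : ∀ q, e q ∈ q.1.1 := by
    rintro ⟨s, b⟩
    cases b
    · exact Sym2.out_fst_mem _
    · exact Sym2.out_snd_mem _
  have huniq : ∀ v (s t : Sym2 V), s ∈ M.edgeSet → t ∈ M.edgeSet → v ∈ s → v ∈ t → s = t := by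
    intro v s t hs ht hvs hvt
    obtain ⟨a, rfl⟩ := hvs
    obtain ⟨b, rfl⟩ := hvt
    rw [SimpleGraph.Subgraph.mem_edgeSet] at hs ht
    rw [hM.1.eq_of_adj_left hs ht]
  have hinj : Function.Injective e := by
    rintro ⟨s, b⟩ ⟨t, b'⟩ h
    have hst : s = t := Subtype.ext
      (huniq _ _ _ s.2 t.2 (hmem (s, b)) (h ▸ hmem (t, b')))
    subst hst
    have hne := (hout s).ne
    cases b <;> cases b' <;> simp_all [e]
  have hsurj : Function.Surjective e := by
    intro v
    obtain ⟨w, hw, -⟩ := hM.1 (hM.2 v)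
    let s : M.edgeSet := ⟨s(v, w), hw⟩
    have h : s(((Quot.out s.1).1), (Quot.out s.1).2) = s(v, w) := Quot.out_eq s.1
    rcases Sym2.eq_iff.1 h with h | h
    · exact ⟨(s, false), by simpa [e] using h.1⟩
    · exact ⟨(s, true), by simpa [e] using h.2⟩
  have hcard : Fintype.card M.edgeSet = k := by
    have := Fintype.card_of_bijective ⟨hinj, hsurj⟩
    rw [Fintype.card_prod, Fintype.card_bool] at this
    omega
  let φ : Fin k ≃ M.edgeSet := (finCongr hcard.symm).trans (Fintype.equivFin _).symm
  refine ⟨fun q => e (φ q.1, q.2), ⟨?_, ?_⟩, fun i => ?_⟩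
  · intro p q h
    have := hinj h
    simp only [Prod.mk.injEq, φ.injective.eq_iff] at this
    exact Prod.ext this.1 this.2
  · intro v
    obtain ⟨⟨s, b⟩, rfl⟩ := hsurj v
    exact ⟨(φ.symm s, b), by simp⟩
  · exact (hout (φ i)).adj_sub

namespace EdgeColoredMultigraph

variable {V : Type*}

/-- If `k` disjoint pairs of vertices are joined in one color and fewer than `4 * (k - 1)` ordered
pairs of the vertices they cover are not joined in the other color, then some proper cycle
covers exactly these vertices. -/
theorem hasProperCycle_of_pairs [Finite V] (G : EdgeColoredMultigraph V 2) {c c' : Fin 2}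
    (hc : c ≠ c') {k : ℕ} (hk : 2 ≤ k) (e : Fin k × Bool → V) (he : Function.Injective e)
    (hadj : ∀ i, (G.layer c).Adj (e (i, false)) (e (i, true)))
    (hcard : {p | p ∈ (G.layer c').nonadjPairs ∧ p.1 ∈ Set.range e ∧ p.2 ∈ Set.range e}.ncard <
      4 * (k - 1)) :
    G.HasProperCycle (2 * k) := by
  classical
  let B : Set ((Fin k × Bool) × (Fin k × Bool)) :=
    {p | p.1.1 ≠ p.2.1 ∧ ¬ (G.layer c').Adj (e p.1) (e p.2)}
  have hB : B.ncard < 4 * (k - 1) := by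
    refine lt_of_le_of_lt ?_ hcard
    refine Set.ncard_le_ncard_of_injOn (fun p => (e p.1, e p.2)) ?_ ?_ (Set.toFinite _)
    · rintro p ⟨h1, h2⟩
      exact ⟨⟨fun h => h1 (congrArg Prod.fst (he h)), h2⟩, ⟨_, rfl⟩, ⟨_, rfl⟩⟩
    · intro p _ q _ h
      simp only [Prod.mk.injEq] at h
      exact Prod.ext (he h.1) (he h.2)
  obtain ⟨σ, ε, hσ⟩ := exists_perm_orientation hk B (fun p hp => hp.1) hB
  have hnext : ∀ i, (G.layer c').Adj (e (σ i, !ε (σ i)))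
      (e (σ (finRotate k i), ε (σ (finRotate k i)))) := by
    intro i
    by_contra h
    exact hσ i ⟨σ.injective.ne (finRotate_ne_self hk i), h⟩
  have hpair : ∀ i b, (G.layer c).Adj (e (i, b)) (e (i, !b)) := by
    intro i b
    cases b
    exacts [hadj i, (hadj i).symm]
  -- Positions `2i` and `2i + 1` carry the start and the end of the `i`-th pair in the order `σ`, so
  -- steps from even positions use `c` and steps from odd ones use `c'`.
  let h : Fin (2 * k) → Fin k := fun j => ⟨j / 2, by omega⟩
  let vtx : Fin (2 * k) → V := fun j =>
    e (σ (h j), if (j : ℕ) % 2 = 0 then ε (σ (h j)) else !ε (σ (h j)))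
  have hk' : 0 < 2 * k := by omega
  have hmod : ∀ j : Fin (2 * k), ((finRotate (2 * k) j : ℕ)) % 2 = (j + 1) % 2 := by
    intro j
    rw [val_finRotate_of_pos hk', Nat.mod_mul_right_mod]
  have heven : ∀ j : Fin (2 * k), (j : ℕ) % 2 = 0 → h (finRotate _ j) = h j := by
    intro j hj
    apply Fin.ext
    simp only [h]
    rw [val_finRotate_of_pos hk', Nat.mod_eq_of_lt (by omega)]
    omega
  have hodd : ∀ j : Fin (2 * k), (j : ℕ) % 2 ≠ 0 → h (finRotate _ j) = finRotate k (h j) := by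
    intro j hj
    apply Fin.ext
    simp only [h]
    rw [val_finRotate_of_pos hk', val_finRotate_of_pos (by omega), Nat.mod_mul_right_div_self]
    congr 1
    simp only
    omega
  refine ⟨⟨by omega, vtx, fun j => if (j : ℕ) % 2 = 0 then c else c', ?_, ?_, ?_⟩⟩
  · intro i j hij
    have h1 := he hij
    simp only [Prod.mk.injEq, σ.injective.eq_iff] at h1
    obtain ⟨h1, h2⟩ := h1
    rw [h1] at h2
    have h3 : (i : ℕ) / 2 = j / 2 := congrArg Fin.val h1
    have h4 : (i : ℕ) % 2 = j % 2 := by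
      rcases Nat.mod_two_eq_zero_or_one i with hi | hi <;>
        rcases Nat.mod_two_eq_zero_or_one j with hj | hj <;> simp_all
    apply Fin.ext
    omega
  · intro j
    by_cases hj : (j : ℕ) % 2 = 0
    · have hj' : ¬ ((finRotate (2 * k) j : ℕ)) % 2 = 0 := by rw [hmod]; omega
      simp only [vtx]
      rw [if_pos hj, if_pos hj, if_neg hj', heven j hj]
      exact hpair _ _
    · have hj' : ((finRotate (2 * k) j : ℕ)) % 2 = 0 := by rw [hmod]; omega
      simp only [vtx]
      rw [if_neg hj, if_neg hj, if_pos hj', hodd j hj]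
      exact hnext _
  · intro j
    have := hmod j
    by_cases hj : (j : ℕ) % 2 = 0
    · rw [if_pos hj, if_neg (by omega)]
      exact hc
    · rw [if_neg hj, if_pos (by omega)]
      exact hc.symm

theorem HasProperCycle.hasProperHamiltonianCycle [Fintype V] {c : ℕ}
    {G : EdgeColoredMultigraph V c} (h : G.HasProperCycle (Fintype.card V)) :
    G.HasProperHamiltonianCycle := by
  obtain ⟨C⟩ := h
  exact ⟨_, C, ((Fintype.bijective_iff_injective_and_card C.vertex).2 ⟨C.injective, by simp⟩).2⟩

theorem numEdges_eq_sum [Finite V] {c : ℕ} (G : EdgeColoredMultigraph V c) :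
    G.numEdges = ∑ i, (G.layer i).edgeSet.ncard := by
  classical
  rw [numEdges]
  have h : ∀ i : Fin c, ((G.layer i).edgeSet).ncard = Nat.card (G.layer i).edgeSet :=
    fun i => (Nat.card_coe_set_eq _).symm
  simp only [h]
  rw [← Nat.card_sigma, ← Nat.card_coe_set_eq]
  exact Nat.card_congr
    { toFun := fun s => ⟨s.1.2, s.1.1, s.2⟩
      invFun := fun s => ⟨(s.2.1, s.1), s.2.2⟩
      left_inv := fun _ => rfl
      right_inv := fun _ => rfl }

theorem exists_adj_of_rainbowDegree_eq {c : ℕ} {G : EdgeColoredMultigraph V c}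
    (h : G.rainbowDegree = c) (i : Fin c) (x : V) : ∃ y, (G.layer i).Adj x y := by
  have h1 : c ≤ G.vertexRainbowDegree x := by
    conv_lhs => rw [← h]
    exact ciInf_le (OrderBot.bddBelow _) x
  have h2 : {i : Fin c | ∃ y, (G.layer i).Adj x y} = Set.univ := by
    refine Set.eq_of_subset_of_ncard_le (Set.subset_univ _) ?_ (Set.toFinite _)
    rw [Set.ncard_univ, Nat.card_eq_fintype_card, Fintype.card_fin]
    exact h1
  have : i ∈ {i : Fin c | ∃ y, (G.layer i).Adj x y} := h2 ▸ Set.mem_univ i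
  exact this

end EdgeColoredMultigraph

/-! ### Matchings that leave out one vertex. -/

namespace SimpleGraph

variable {V : Type*}

/-- The graph obtained by adding a new vertex adjacent to exactly the vertices of `D`. -/
def addVertex (Γ : SimpleGraph V) (D : Set V) : SimpleGraph (Option V) where
  Adj
    | some v, some w => Γ.Adj v w
    | none, some v => v ∈ D
    | some v, none => v ∈ D
    | none, none => False
  symm := ⟨by rintro (_ | v) (_ | w) h; exacts [h, h, h, Γ.adj_symm h]⟩
  loopless := ⟨by rintro (_ | v) h; exacts [h, Γ.irrefl h]⟩

theorem ncard_nonadjPairs_addVertex_le [Finite V] (Γ : SimpleGraph V) (D : Set V) :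
    (Γ.addVertex D).nonadjPairs.ncard ≤ Γ.nonadjPairs.ncard + 2 * Dᶜ.ncard := by
  have hsub : (Γ.addVertex D).nonadjPairs ⊆
      ((fun p : V × V => (some p.1, some p.2)) '' Γ.nonadjPairs) ∪
        (((fun v : V => (none, some v)) '' Dᶜ) ∪ ((fun v : V => (some v, none)) '' Dᶜ)) := by
    rintro ⟨_ | v, _ | w⟩ ⟨h1, h2⟩
    · exact absurd rfl h1
    · exact Or.inr (Or.inl ⟨w, h2, rfl⟩)
    · exact Or.inr (Or.inr ⟨v, h2, rfl⟩)
    · exact Or.inl ⟨(v, w), ⟨fun h => h1 (congrArg some h), h2⟩, rfl⟩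
  refine (Set.ncard_le_ncard hsub (Set.toFinite _)).trans ?_
  refine (Set.ncard_union_le _ _).trans (add_le_add (Set.ncard_image_le (Set.toFinite _)) ?_)
  refine (Set.ncard_union_le _ _).trans ?_
  rw [two_mul]
  exact add_le_add (Set.ncard_image_le (Set.toFinite _)) (Set.ncard_image_le (Set.toFinite _))

/-- In a dense graph of odd order there is a matching that misses exactly one vertex, and this
vertex can be required to lie in a given set `D`. -/
theorem exists_pairs_of_odd [Fintype V] (Γ : SimpleGraph V) (D : Set V) (hD : D.Nonempty) {k : ℕ}
    (hk : Fintype.card V = 2 * k + 1) (h9 : 9 ≤ Fintype.card V) (hdeg : ∀ v, ∃ w, Γ.Adj v w)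
    (hcard : Γ.nonadjPairs.ncard + 2 * Dᶜ.ncard + 8 ≤ 4 * Fintype.card V) :
    ∃ e : Fin k × Bool → V, Function.Injective e ∧
      (∀ i, Γ.Adj (e (i, false)) (e (i, true))) ∧ ∃ v ∈ D, v ∉ Set.range e := by
  -- The enlarged graph has `N = n + 1 ≥ 10` vertices, and `4N - 12 = 4n - 8`. The partner of the
  -- new vertex lies in `D`; dropping their pair `i₀` leaves the desired matching.
  have hc : Fintype.card (Option V) = 2 * (k + 1) := by rw [Fintype.card_option]; omega
  obtain ⟨M, hM⟩ := exists_isPerfectMatching_of_ncard_nonadjPairs_le (Γ.addVertex D) (by omega)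
    (hc ▸ even_two_mul _)
    (by
      rintro (_ | v)
      · exact hD.elim fun v hv => ⟨some v, hv⟩
      · exact (hdeg v).elim fun w hw => ⟨some w, hw⟩)
    (by
      have := ncard_nonadjPairs_addVertex_le Γ D
      omega)
  obtain ⟨f, hf, hadj⟩ := hM.exists_bijective_adj hc
  obtain ⟨⟨i₀, b₀⟩, h₀⟩ := hf.2 none
  have hv : ∃ v ∈ D, f (i₀, !b₀) = some v := by
    have h1 : (Γ.addVertex D).Adj (f (i₀, b₀)) (f (i₀, !b₀)) := by
      cases b₀
      exacts [hadj i₀, (hadj i₀).symm]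
    rw [h₀] at h1
    cases h2 : f (i₀, !b₀) with
    | none => rw [h2] at h1; exact h1.elim
    | some v => rw [h2] at h1; exact ⟨v, h1, rfl⟩
  obtain ⟨v, hvD, hv⟩ := hv
  have hsome : ∀ q : Fin k × Bool, ∃ w, f (i₀.succAbove q.1, q.2) = some w := by
    intro q
    refine Option.ne_none_iff_exists'.1 fun h => ?_
    have := hf.1 (h.trans h₀.symm)
    exact Fin.succAbove_ne i₀ q.1 (congrArg Prod.fst this)
  choose e he using hsome
  refine ⟨e, ?_, ?_, v, hvD, ?_⟩
  · intro p q h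
    have := hf.1 ((he p).trans ((congrArg some h).trans (he q).symm))
    simp only [Prod.mk.injEq, Fin.succAbove_right_inj] at this
    exact Prod.ext this.1 this.2
  · intro i
    have := hadj (i₀.succAbove i)
    rwa [he (i, false), he (i, true)] at this
  · rintro ⟨q, rfl⟩
    have := hf.1 (hv.trans (he q).symm)
    exact Fin.succAbove_ne i₀ q.1 (congrArg Prod.fst this).symm

end SimpleGraph

/-! ### Existence of the cycles for even and odd order. -/

namespace EdgeColoredMultigraph

variable {V : Type*}

theorem two_mul_choose_two (n : ℕ) : 2 * n.choose 2 = n * (n - 1) := by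
  rw [Nat.choose_two_right, Nat.mul_div_cancel' (Nat.even_mul_pred_self _).two_dvd]

theorem ncard_nonadjPairs_add_le [Fintype V] (G : EdgeColoredMultigraph V 2)
    (h3 : 3 ≤ Fintype.card V)
    (hm : (Fintype.card V).choose 2 + (Fintype.card V - 2).choose 2 + 3 ≤ G.numEdges) :
    (G.layer 0).nonadjPairs.ncard + (G.layer 1).nonadjPairs.ncard + 12 ≤ 4 * Fintype.card V := by
  have h0 := (G.layer 0).two_mul_ncard_edgeSet_add_ncard_nonadjPairs
  have h1 := (G.layer 1).two_mul_ncard_edgeSet_add_ncard_nonadjPairs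
  rw [numEdges_eq_sum, Fin.sum_univ_two] at hm
  obtain ⟨m, hm'⟩ := Nat.exists_eq_add_of_le' h3
  rw [hm'] at hm h0 h1 ⊢
  have e1 : 2 * (m + 3).choose 2 = (m + 3) * (m + 2) := two_mul_choose_two _
  have e2 : 2 * (m + 1).choose 2 = (m + 1) * m := two_mul_choose_two _
  have e3 : m + 3 - 2 = m + 1 := by omega
  have e4 : m + 3 - 1 = m + 2 := by omega
  rw [e3] at hm
  rw [e4] at h0 h1
  nlinarith

theorem hasProperHamiltonianCycle_of_even [Fintype V] (G : EdgeColoredMultigraph V 2)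
    {c c' : Fin 2} (hc : c ≠ c') (h10 : 10 ≤ Fintype.card V) (heven : Even (Fintype.card V))
    (hdeg : ∀ v, ∃ w, (G.layer c).Adj v w)
    (h : (G.layer c).nonadjPairs.ncard + (G.layer c').nonadjPairs.ncard + 12 ≤ 4 * Fintype.card V)
    (hle : (G.layer c').nonadjPairs.ncard ≤ (G.layer c).nonadjPairs.ncard) :
    G.HasProperHamiltonianCycle := by
  obtain ⟨M, hM⟩ := (G.layer c).exists_isPerfectMatching_of_ncard_nonadjPairs_le h10 heven hdeg
    (by omega)
  obtain ⟨k, hk⟩ := heven.two_dvd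
  obtain ⟨e, he, hadj⟩ := hM.exists_bijective_adj hk
  refine HasProperCycle.hasProperHamiltonianCycle ?_
  rw [hk]
  refine G.hasProperCycle_of_pairs hc (by omega) e he.1 hadj ?_
  refine lt_of_le_of_lt (Set.ncard_le_ncard (fun p hp => hp.1) (Set.toFinite _)) ?_
  omega

/-- If `c'` misses fewer than `4(k - 1) = 2n - 6` pairs, any vertex may be left out. Otherwise `c`
too misses at most `2n - 6`, which leaves room for a prescribed nonempty set `D` of admissible
vertices, as `2|Dᶜ| ≤ 2n - 2`. -/
theorem hasProperCycle_of_odd [Fintype V] (G : EdgeColoredMultigraph V 2)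
    {c c' : Fin 2} (hc : c ≠ c') (h9 : 9 ≤ Fintype.card V) (hodd : Odd (Fintype.card V))
    (hdeg : ∀ v, ∃ w, (G.layer c).Adj v w)
    (h : (G.layer c).nonadjPairs.ncard + (G.layer c').nonadjPairs.ncard + 12 ≤ 4 * Fintype.card V)
    (hle : (G.layer c').nonadjPairs.ncard ≤ (G.layer c).nonadjPairs.ncard) :
    G.HasProperCycle (Fintype.card V - 1) := by
  obtain ⟨k, hk⟩ := hodd
  rw [show Fintype.card V - 1 = 2 * k by omega]
  rcases Nat.lt_or_ge (G.layer c').nonadjPairs.ncard (4 * (k - 1)) with hlt | hge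
  · have : Nonempty V := Fintype.card_pos_iff.1 (by omega)
    obtain ⟨e, he, hadj, -⟩ := (G.layer c).exists_pairs_of_odd Set.univ Set.univ_nonempty hk h9
      hdeg (by simp; omega)
    refine G.hasProperCycle_of_pairs hc (by omega) e he hadj ?_
    exact lt_of_le_of_lt (Set.ncard_le_ncard (fun p hp => hp.1) (Set.toFinite _)) hlt
  · let D : Set V := {v | ∃ w, (v, w) ∈ (G.layer c').nonadjPairs}
    obtain ⟨⟨a, b⟩, hab⟩ := Set.nonempty_of_ncard_ne_zero
      (show (G.layer c').nonadjPairs.ncard ≠ 0 by omega)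
    have hD : D.Nonempty := ⟨a, b, hab⟩
    have hDc : Dᶜ.ncard + 1 ≤ Fintype.card V := by
      have h1 := Set.ncard_add_ncard_compl D
      have h2 := (Set.ncard_pos (Set.toFinite _)).2 hD
      rw [Nat.card_eq_fintype_card] at h1
      omega
    obtain ⟨e, he, hadj, v, ⟨w, hvw⟩, hv⟩ := (G.layer c).exists_pairs_of_odd D hD hk h9 hdeg
      (by omega)
    refine G.hasProperCycle_of_pairs hc (by omega) e he hadj ?_
    -- The missing pair `(v, w)` is lost with `v`, which gives the strict inequality.
    have hss := Set.ncard_lt_ncard (s := {p | p ∈ (G.layer c').nonadjPairs ∧ p.1 ∈ Set.range e ∧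
      p.2 ∈ Set.range e}) (t := (G.layer c').nonadjPairs)
      ⟨fun p hp => hp.1, fun hsub => hv (hsub hvw).2.1⟩ (Set.toFinite _)
    omega

/-! ### The extremal example. -/

/-- All edges of color `0`, and all edges of color `1` except those joining `0` or `1` to a vertex
other than `2`. -/
def twoPendant (n : ℕ) : EdgeColoredMultigraph (Fin n) 2 where
  layer i := if i = 0 then ⊤ else SimpleGraph.fromRel fun a b : Fin n =>
    (2 ≤ a.val ∧ 2 ≤ b.val) ∨ a.val = 2

theorem twoPendant_layer_zero_adj {n : ℕ} {a b : Fin n} :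
    ((twoPendant n).layer 0).Adj a b ↔ a ≠ b := by
  simp [twoPendant]

theorem twoPendant_layer_one_adj {n : ℕ} {a b : Fin n} :
    ((twoPendant n).layer 1).Adj a b ↔
      a ≠ b ∧ ((2 ≤ a.val ∧ 2 ≤ b.val) ∨ a.val = 2 ∨ b.val = 2) := by
  simp only [twoPendant, one_ne_zero, if_false, SimpleGraph.fromRel_adj]
  tauto

theorem twoPendant_connected {n : ℕ} (hn : 0 < n) : (twoPendant n).Connected := by
  have : Nonempty (Fin n) := ⟨⟨0, hn⟩⟩
  have h : (⨆ i, (twoPendant n).layer i) = ⊤ :=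
    top_le_iff.1 (le_iSup_of_le 0 fun a b h => twoPendant_layer_zero_adj.2 h)
  rw [Connected, h]
  exact SimpleGraph.connected_top

theorem twoPendant_rainbowDegree {n : ℕ} (hn : 4 ≤ n) : (twoPendant n).rainbowDegree = 2 := by
  have : Nonempty (Fin n) := ⟨⟨0, by omega⟩⟩
  have h : ∀ x, (twoPendant n).vertexRainbowDegree x = 2 := by
    intro x
    have hu : {i : Fin 2 | ∃ y, ((twoPendant n).layer i).Adj x y} = Set.univ := by
      refine Set.eq_univ_of_forall fun i => ?_
      by_cases hx : x.val = 2
      · refine ⟨⟨3, by omega⟩, ?_⟩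
        have hne : x ≠ ⟨3, by omega⟩ := fun h => by simp [h] at hx
        fin_cases i
        · exact twoPendant_layer_zero_adj.2 hne
        · exact twoPendant_layer_one_adj.2 ⟨hne, Or.inr (Or.inl hx)⟩
      · refine ⟨⟨2, by omega⟩, ?_⟩
        have hne : x ≠ ⟨2, by omega⟩ := fun h => hx (by simp [h])
        fin_cases i
        · exact twoPendant_layer_zero_adj.2 hne
        · exact twoPendant_layer_one_adj.2 ⟨hne, Or.inr (Or.inr rfl)⟩
    rw [vertexRainbowDegree, hu, Set.ncard_univ, Nat.card_eq_fintype_card, Fintype.card_fin]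
  simp [rainbowDegree, h]

theorem twoPendant_numEdges {n : ℕ} (hn : 4 ≤ n) :
    (twoPendant n).numEdges = n.choose 2 + (n - 2).choose 2 + 2 := by
  have hcard : ∀ S : Finset (Fin n), S.offDiag.card = S.card * (S.card - 1) := fun S => by
    rw [Finset.offDiag_card, Nat.mul_sub_one]
  have h0 := ((twoPendant n).layer 0).two_mul_ncard_edgeSet_add_ncard_nonadjPairs
  have h1 := ((twoPendant n).layer 1).two_mul_ncard_edgeSet_add_ncard_nonadjPairs
  obtain ⟨m, rfl⟩ := Nat.exists_eq_add_of_le' hn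
  have hz : ((twoPendant (m + 4)).layer 0).nonadjPairs = ∅ :=
    Set.eq_empty_of_forall_notMem fun p hp => hp.2 (twoPendant_layer_zero_adj.2 hp.1)
  let v : Fin (m + 4) := ⟨2, by omega⟩
  let T : Finset (Fin (m + 4)) := {⟨0, by omega⟩, ⟨1, by omega⟩, v}
  have hv : ∀ a, a = v ↔ a.val = 2 := fun a => Fin.ext_iff
  have hT : ∀ a, a ∈ T ↔ a.val ≤ 2 := by
    intro a
    simp only [T, v, Finset.mem_insert, Finset.mem_singleton, Fin.ext_iff]
    omega
  have hTc : T.card = 3 := by simp [T, v]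
  have hvT : ({v} : Finset (Fin (m + 4)))ᶜ.card = m + 3 := by
    rw [Finset.card_compl, Finset.card_singleton, Fintype.card_fin]
    rfl
  have hTT : Tᶜ.card = m + 1 := by
    rw [Finset.card_compl, hTc, Fintype.card_fin]
    rfl
  have hsub : Tᶜ.offDiag ⊆ ({v} : Finset (Fin (m + 4)))ᶜ.offDiag :=
    Finset.offDiag_mono (Finset.compl_subset_compl.2 (by simp [T]))
  -- A pair is missing exactly when it avoids the vertex `2` and meets `{0, 1}`.
  have ho : ((twoPendant (m + 4)).layer 1).nonadjPairs =
      (({v} : Finset (Fin (m + 4)))ᶜ.offDiag \ Tᶜ.offDiag : Finset _) := by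
    ext ⟨a, b⟩
    simp only [SimpleGraph.nonadjPairs, Set.mem_ofPred_eq, twoPendant_layer_one_adj,
      Finset.mem_coe, Finset.mem_sdiff, Finset.mem_offDiag, Finset.mem_compl,
      Finset.mem_singleton, hT, hv]
    by_cases hab : a = b
    · simp [hab]
    · simp only [ne_eq, hab, not_false_eq_true, true_and, and_true]
      omega
  rw [hz, Set.ncard_empty, Fintype.card_fin] at h0
  rw [ho, Set.ncard_coe_finset, Finset.card_sdiff_of_subset hsub, hcard, hcard, hvT, hTT,
    Fintype.card_fin] at h1
  rw [numEdges_eq_sum, Fin.sum_univ_two]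
  have e1 := two_mul_choose_two (m + 4)
  have e2 := two_mul_choose_two (m + 2)
  have e3 : (m + 3) * (m + 3 - 1) - (m + 1) * (m + 1 - 1) = 4 * m + 6 := by
    simp only [Nat.add_sub_cancel, show m + 3 - 1 = m + 2 by omega]
    refine Nat.sub_eq_of_eq_add ?_
    ring
  rw [e3] at h1
  rw [show m + 4 - 2 = m + 2 by omega]
  rw [show m + 4 - 1 = m + 3 by omega] at *
  rw [show m + 2 - 1 = m + 1 by omega] at *
  nlinarith

/-- Colors alternate, so each vertex of a proper cycle lies on exactly one of its edges of color
`1`. For both `0` and `1` that edge would have to lead to `2`. -/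
theorem twoPendant_not_hasProperHamiltonianCycle {n : ℕ} (hn : 4 ≤ n) :
    ¬ (twoPendant n).HasProperHamiltonianCycle := by
  rintro ⟨k, C, hC⟩
  have hcol : ∀ j, C.color j ≠ 1 → C.color (finRotate k j) = 1 := by
    intro j hj
    have := C.proper j
    omega
  have hcol' : ∀ j, C.color j = 1 → C.color (finRotate k j) ≠ 1 := by
    intro j hj h
    exact C.proper j (hj.trans h.symm)
  have hnb : ∀ j, C.color j = 1 → ∀ x : Fin n, x.val < 2 →
      (C.vertex j = x → (C.vertex (finRotate k j)).val = 2) ∧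
      (C.vertex (finRotate k j) = x → (C.vertex j).val = 2) := by
    intro j hj x hx
    have h := C.adj j
    rw [hj, twoPendant_layer_one_adj] at h
    constructor <;> rintro rfl <;> omega
  obtain ⟨z, hz⟩ := hC ⟨2, by omega⟩
  have hz' : ∀ j, (C.vertex j).val = 2 → j = z := fun j hj =>
    C.injective (hz ▸ Fin.ext hj)
  have key : ∀ x : Fin n, x.val < 2 →
      (C.color z = 1 ∧ C.vertex (finRotate k z) = x) ∨
      (C.color z ≠ 1 ∧ C.vertex ((finRotate k).symm z) = x) := by
    intro x hx
    obtain ⟨i, hi⟩ := hC x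
    by_cases h1 : C.color i = 1
    · have := hz' _ ((hnb i h1 x hx).1 hi)
      refine Or.inr ⟨this ▸ hcol' i h1, ?_⟩
      rw [← this, Equiv.symm_apply_apply, hi]
    · obtain ⟨j, rfl⟩ := (finRotate k).surjective i
      have hj : C.color j = 1 := by
        by_contra h
        exact h1 (hcol j h)
      have := hz' _ ((hnb j hj x hx).2 hi)
      subst this
      exact Or.inl ⟨hj, hi⟩
  have h01 : (⟨0, by omega⟩ : Fin n) ≠ ⟨1, by omega⟩ := by simp
  rcases key ⟨0, by omega⟩ (by simp) with ⟨a, b⟩ | ⟨a, b⟩ <;>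
    rcases key ⟨1, by omega⟩ (by simp) with ⟨a', b'⟩ | ⟨a', b'⟩
  · exact h01 (b.symm.trans b')
  · exact a' a
  · exact a a'
  · exact h01 (b.symm.trans b')

end EdgeColoredMultigraph

theorem theorem3 :
    (∀ (V : Type*) [Fintype V] (G : EdgeColoredMultigraph V 2) (n : ℕ),
      Fintype.card V = n → 9 ≤ n → G.rainbowDegree = 2 →
      n.choose 2 + (n - 2).choose 2 + 3 ≤ G.numEdges →
        (Even n → G.HasProperHamiltonianCycle) ∧ (Odd n → G.HasProperCycle (n - 1))) ∧
    (∀ n : ℕ, 9 ≤ n → Even n →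
      ∃ G : EdgeColoredMultigraph (Fin n) 2,
        G.Connected ∧ G.rainbowDegree = 2 ∧
        G.numEdges = n.choose 2 + (n - 2).choose 2 + 2 ∧
        ¬ G.HasProperHamiltonianCycle) := by
  refine ⟨?_, fun n hn _ => ⟨EdgeColoredMultigraph.twoPendant n, EdgeColoredMultigraph.twoPendant_connected (by omega),
    EdgeColoredMultigraph.twoPendant_rainbowDegree (by omega), EdgeColoredMultigraph.twoPendant_numEdges (by omega),
    EdgeColoredMultigraph.twoPendant_not_hasProperHamiltonianCycle (by omega)⟩⟩
  rintro V _ G n rfl h9 hr hm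
  have hdeg := EdgeColoredMultigraph.exists_adj_of_rainbowDegree_eq hr
  have hN := G.ncard_nonadjPairs_add_le (by omega) hm
  have hc : ∃ c c' : Fin 2, c ≠ c' ∧
      (G.layer c).nonadjPairs.ncard + (G.layer c').nonadjPairs.ncard + 12 ≤ 4 * Fintype.card V ∧
      (G.layer c').nonadjPairs.ncard ≤ (G.layer c).nonadjPairs.ncard := by
    rcases le_total (G.layer 1).nonadjPairs.ncard (G.layer 0).nonadjPairs.ncard with h | h
    · exact ⟨0, 1, by decide, hN, h⟩
    · exact ⟨1, 0, by decide, by omega, h⟩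
  obtain ⟨c, c', hcc, hsum, hle⟩ := hc
  refine ⟨fun heven => ?_, fun hodd => ?_⟩
  · have h10 : 10 ≤ Fintype.card V := by
      obtain ⟨r, hr⟩ := heven
      omega
    exact G.hasProperHamiltonianCycle_of_even hcc h10 heven (hdeg c) hsum hle
  · exact G.hasProperCycle_of_odd hcc h9 hodd (hdeg c) hsum hle
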